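/- Let $R\in M_d(\mathbb Z)$ be an expansive matrix (all its complex eigenvalues have modulus $>1$) and let $B,L\subset\mathbb Z^d$ be nonempty finite sets with $N:=\#B=\#L$ such that $(R,B,L)$ is a Hadamard triple, i.e. the matrix $$H=\frac1{\sqrt N}\left[e^{2\pi i\langle R^{-1}b,\ell\rangle}\right]_{\ell\in L,\,b\in B}$$ is unitary. Let $\mu=\mu(R,B)$ be the associated self-affine measure, i.e. the unique Borel probability measure on $\mathbb R^d$ with $$\mu(E)=\sum_{b\in B}\frac1N\,\mu(\tau_b^{-1}(E))\quad\text{for all Borel sets }E\subseteq\mathbb R^d,\qquad \tau_b(x)=R^{-1}(x+b),$$ let $\widehat\mu(\xi)=\int e^{-2\pi i\langle\xi,x\rangle}\,d\mu(x)$, and let $$\mathcal Z=\{\xi\in\mathbb R^d:\ \widehat\mu(\xi+k)=0\ \text{for all }k\in\mathbb Z^d\}.$$ A countable set $\Lambda\subset\mathbb R^d$ is called a spectrum of $\mu$ if $\{e^{2\pi i\langle\lambda,x\rangle}:\lambda\in\Lambda\}$ is an orthonormal basis of $L^2(\mu)$, and $\mu$ is called spectral if it has a spectrum. Then the following are equivalent: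 (1) $\mathcal Z=\emptyset$; (2) $\mu$ has a spectrum contained in $\mathbb Z^d$. In particular, if $\mathcal Z=\emptyset$, then $\mu$ is a spectral measure. -/

import Mathlib

open MeasureTheory ProbabilityTheory
open scoped ENNReal

/-- The vector of `ℝ^d` (with its Euclidean structure) given by an integer vector. -/
noncomputable def intVec {d : ℕ} (k : Fin d → ℤ) : EuclideanSpace ℝ (Fin d) :=
  WithLp.toLp 2 (fun i => (k i : ℝ))

/-- An integer matrix is expansive if all its complex eigenvalues have modulus `> 1`. -/
def IsExpansive {d : ℕ} (R : Matrix (Fin d) (Fin d) ℤ) : Prop :=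
  ∀ z : ℂ, Module.End.HasEigenvalue
    (Matrix.toLin' (R.map (Int.cast : ℤ → ℂ))) z → 1 < ‖z‖

/-- The linear map `R⁻¹` of `ℝ^d`. -/
noncomputable def invMap {d : ℕ} (R : Matrix (Fin d) (Fin d) ℤ) :
    EuclideanSpace ℝ (Fin d) →L[ℝ] EuclideanSpace ℝ (Fin d) :=
  Matrix.toEuclideanCLM (n := Fin d) (𝕜 := ℝ) (R.map (Int.cast : ℤ → ℝ))⁻¹

/-- The maps `τ_b(x) = R⁻¹(x + b)` of the affine iterated function system. -/
noncomputable def ifsMap {d : ℕ} (R : Matrix (Fin d) (Fin d) ℤ) (b : Fin d → ℤ)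
    (x : EuclideanSpace ℝ (Fin d)) : EuclideanSpace ℝ (Fin d) :=
  invMap R (x + intVec b)

/-- The matrix `N^{-1/2} [exp(2πi⟨R⁻¹b, ℓ⟩)]`, rows indexed by `L`, columns by `B`, `N = #B`. -/
noncomputable def hadamardMatrix {d : ℕ} (R : Matrix (Fin d) (Fin d) ℤ)
    (B L : Finset (Fin d → ℤ)) : Matrix L B ℂ :=
  Matrix.of fun ℓ b => (1 / (Real.sqrt (B.card : ℝ) : ℂ)) *
    Complex.exp (2 * Real.pi * Complex.I *
      ((inner ℝ (invMap R (intVec b.1)) (intVec ℓ.1) : ℝ) : ℂ))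

/-- `(R, B, L)` is a Hadamard triple: `R` is an expansive integer matrix, `B` and `L` are
(nonempty) finite sets of integer vectors of the same size, and the matrix above is unitary. -/
structure IsHadamardTriple {d : ℕ} (R : Matrix (Fin d) (Fin d) ℤ)
    (B L : Finset (Fin d → ℤ)) : Prop where
  expansive : IsExpansive R
  nonempty : B.Nonempty
  card_eq : B.card = L.card
  isometry : (hadamardMatrix R B L).conjTranspose * hadamardMatrix R B L = 1

/-- `μ` is a Borel probability measure with `μ(E) = ∑_{b ∈ B} (1/N) μ(τ_b⁻¹(E))` for all Borel
sets `E`. -/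
structure IsSelfAffineMeasure {d : ℕ} (R : Matrix (Fin d) (Fin d) ℤ)
    (B : Finset (Fin d → ℤ)) (μ : Measure (EuclideanSpace ℝ (Fin d))) : Prop where
  isProbabilityMeasure : IsProbabilityMeasure μ
  invariance : ∀ E : Set (EuclideanSpace ℝ (Fin d)), MeasurableSet E →
    μ E = ∑ b ∈ B, (B.card : ℝ≥0∞)⁻¹ * μ (ifsMap R b ⁻¹' E)

open Classical in
/-- The self-affine measure `μ(R, B)`: the unique probability measure with the invariance above.
Existence and uniqueness, for `R` expansive and `B` nonempty, are proved below; otherwise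
the value is `0` if there is no such measure. -/
noncomputable def selfAffineMeasure {d : ℕ} (R : Matrix (Fin d) (Fin d) ℤ)
    (B : Finset (Fin d → ℤ)) : Measure (EuclideanSpace ℝ (Fin d)) :=
  if h : ∃ μ, IsSelfAffineMeasure R B μ then h.choose else 0

/-- The Fourier transform `μ̂(ξ) = ∫ exp(-2πi⟨ξ, x⟩) dμ(x)`. -/
noncomputable def fourierHat {d : ℕ} (μ : Measure (EuclideanSpace ℝ (Fin d)))
    (ξ : EuclideanSpace ℝ (Fin d)) : ℂ :=
  ∫ x, Complex.exp (-(2 * Real.pi * Complex.I * ((inner ℝ ξ x : ℝ) : ℂ))) ∂μ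

/-- The periodic zero set `{ξ ∈ ℝ^d : μ̂(ξ + k) = 0 for all k ∈ ℤ^d}`. -/
def periodicZeroSet {d : ℕ} (μ : Measure (EuclideanSpace ℝ (Fin d))) :
    Set (EuclideanSpace ℝ (Fin d)) :=
  {ξ | ∀ k : Fin d → ℤ, fourierHat μ (ξ + intVec k) = 0}

/-- `Λ` is a spectrum of `μ`: it is countable and the exponentials `x ↦ exp(2πi⟨lam, x⟩)`,
`lam ∈ Λ`, form an orthonormal (Hilbert) basis of `L²(μ)`. -/
def IsSpectrum {d : ℕ} (μ : Measure (EuclideanSpace ℝ (Fin d)))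
    (Λ : Set (EuclideanSpace ℝ (Fin d))) : Prop :=
  Λ.Countable ∧ ∃ e : HilbertBasis Λ ℂ (Lp ℂ 2 μ), ∀ lam : Λ,
    e lam =ᵐ[μ] fun x => Complex.exp (2 * Real.pi * Complex.I *
      ((inner ℝ (lam : EuclideanSpace ℝ (Fin d)) x : ℝ) : ℂ))

/-- `μ` is a spectral measure. -/
def IsSpectralMeasure {d : ℕ} (μ : Measure (EuclideanSpace ℝ (Fin d))) : Prop :=
  ∃ Λ : Set (EuclideanSpace ℝ (Fin d)), IsSpectrum μ Λ

/-! Existence and uniqueness of the self-affine measure. -/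

theorem summable_norm_pow_of_expansive {d : ℕ} {R : Matrix (Fin d) (Fin d) ℤ}
    (hR : IsExpansive R) : Summable fun k : ℕ => ‖(invMap R) ^ k‖ := by
  set M : Matrix (Fin d) (Fin d) ℂ := R.map (Int.cast : ℤ → ℂ) with hM
  have hspec : ∀ z ∈ spectrum ℂ M, 1 < ‖z‖ := by
    intro z hz
    apply hR z
    rw [Module.End.hasEigenvalue_iff_mem_spectrum, Matrix.spectrum_toLin']
    exact hz
  have hunit : IsUnit M := by
    by_contra h
    have := hspec 0 ((spectrum.zero_mem_iff ℂ).2 h)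
    simp at this
    linarith
  obtain ⟨u, hu⟩ := hunit
  have hinv : M⁻¹ = ((u⁻¹ : (Matrix (Fin d) (Fin d) ℂ)ˣ) : Matrix (Fin d) (Fin d) ℂ) := by
    rw [← hu, Matrix.coe_units_inv]
  let g : EuclideanSpace ℂ (Fin d) →L[ℂ] EuclideanSpace ℂ (Fin d) :=
    Matrix.toEuclideanCLM (n := Fin d) (𝕜 := ℂ) M⁻¹
  have hgspec : spectrum ℂ g = spectrum ℂ M⁻¹ :=
    AlgEquiv.spectrum_eq (Matrix.toEuclideanCLM (n := Fin d) (𝕜 := ℂ)) M⁻¹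
  have hspec' : ∀ z ∈ spectrum ℂ g, ‖z‖₊ < 1 := by
    intro z hz
    rw [hgspec] at hz
    have hz0 : z ≠ 0 := by
      rintro rfl
      rw [hinv] at hz
      exact (spectrum.zero_notMem ℂ (u⁻¹).isUnit) hz
    have h2 := (spectrum.inv_mem_iff (r := Units.mk0 z hz0) (a := u⁻¹)).1 (by
      rw [hinv] at hz; simpa using hz)
    have h3 := hspec z⁻¹ (by rw [← hu]; simpa using h2)
    rw [norm_inv, one_lt_inv_iff₀] at h3
    exact h3.2
  have hrad : spectralRadius ℂ g < 1 := by
    by_cases hne : (spectrum ℂ g).Nonempty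
    · simpa using spectrum.spectralRadius_lt_of_forall_lt_of_nonempty hne (r := 1) hspec'
    · rw [Set.not_nonempty_iff_eq_empty] at hne
      simp [spectralRadius, hne]
  obtain ⟨r, hr1, hr2⟩ := ENNReal.lt_iff_exists_nnreal_btwn.1 hrad
  have hr2' : r < 1 := by exact_mod_cast hr2
  have hev := (spectrum.pow_nnnorm_pow_one_div_tendsto_nhds_spectralRadius g).eventually
    (gt_mem_nhds hr1)
  have hsum : Summable fun k : ℕ => ‖g ^ k‖ := by
    refine Summable.of_norm_bounded_eventually_nat
      (g := fun k : ℕ => (r : ℝ) ^ k) (summable_geometric_of_lt_one r.2 hr2') ?_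
    filter_upwards [hev, Filter.eventually_gt_atTop 0] with k hk hk0
    have hk' : (0 : ℝ) < k := by exact_mod_cast hk0
    have h1 := ENNReal.rpow_lt_rpow hk hk'
    rw [← ENNReal.rpow_mul, one_div_mul_cancel hk'.ne', ENNReal.rpow_one,
      ENNReal.rpow_natCast] at h1
    rw [norm_norm]
    have h2 : ‖g ^ k‖₊ < r ^ k := by exact_mod_cast h1
    exact_mod_cast h2.le
  have hreal : M⁻¹ = ((R.map (Int.cast : ℤ → ℝ))⁻¹).map (Complex.ofRealHom : ℝ → ℂ) := by
    have hMm : M = (R.map (Int.cast : ℤ → ℝ)).map (Complex.ofRealHom : ℝ → ℂ) := by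
      ext i j; simp [hM]
    have hdet : IsUnit (R.map (Int.cast : ℤ → ℝ)).det := by
      have h1 : IsUnit M.det := (Matrix.isUnit_iff_isUnit_det M).1 ⟨u, hu⟩
      have h2 : M.det = Complex.ofRealHom (R.map (Int.cast : ℤ → ℝ)).det := by
        rw [hMm, RingHom.map_det]; rfl
      rw [h2] at h1
      simpa [isUnit_iff_ne_zero] using h1
    apply Matrix.inv_eq_left_inv
    rw [hMm, ← Matrix.map_mul, Matrix.nonsing_inv_mul _ hdet]
    ext i j; simp [Matrix.one_apply]
  let J : EuclideanSpace ℝ (Fin d) → EuclideanSpace ℂ (Fin d) := fun x =>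
    WithLp.toLp 2 (fun i => (x i : ℂ))
  have hJ : ∀ x, ‖J x‖ = ‖x‖ := by
    intro x
    simp [J, EuclideanSpace.norm_eq]
  have hJg : ∀ x, g (J x) = J (invMap R x) := by
    intro x
    ext i
    change (M⁻¹.mulVec (fun i => (x i : ℂ))) i =
      ((((R.map (Int.cast : ℤ → ℝ))⁻¹).mulVec (fun i => x i) i : ℝ) : ℂ)
    rw [hreal]
    simp [Matrix.mulVec, dotProduct]
  have hJk : ∀ (k : ℕ) x, (g ^ k) (J x) = J ((invMap R ^ k) x) := by
    intro k
    induction k with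
    | zero => intro x; rfl
    | succ k ih =>
      intro x
      rw [pow_succ, pow_succ]
      change (g ^ k) (g (J x)) = J ((invMap R ^ k) (invMap R x))
      rw [hJg, ih]
  refine Summable.of_nonneg_of_le (fun k => norm_nonneg _) (fun k => ?_) hsum
  refine ContinuousLinearMap.opNorm_le_bound _ (norm_nonneg _) fun x => ?_
  rw [← hJ, ← hJk, ← hJ x]
  exact (g ^ k).le_opNorm (J x)

theorem continuous_ifsMap {d : ℕ} (R : Matrix (Fin d) (Fin d) ℤ) (b : Fin d → ℤ) :
    Continuous (ifsMap R b) := by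
  unfold ifsMap; fun_prop

theorem IsSelfAffineMeasure.eq_sum_map {d : ℕ} {R : Matrix (Fin d) (Fin d) ℤ}
    {B : Finset (Fin d → ℤ)} {μ : Measure (EuclideanSpace ℝ (Fin d))}
    (h : IsSelfAffineMeasure R B μ) :
    μ = ∑ b ∈ B, (B.card : ℝ≥0∞)⁻¹ • μ.map (ifsMap R b) := by
  ext E hE
  rw [h.invariance E hE, Measure.finsetSum_apply]
  refine Finset.sum_congr rfl fun b _ => ?_
  rw [Measure.smul_apply, Measure.map_apply (continuous_ifsMap R b).measurable hE, smul_eq_mul]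

theorem IsSelfAffineMeasure.charFun_eq {d : ℕ} {R : Matrix (Fin d) (Fin d) ℤ}
    {B : Finset (Fin d → ℤ)} (hB : B.Nonempty) {μ : Measure (EuclideanSpace ℝ (Fin d))}
    (h : IsSelfAffineMeasure R B μ) (t : EuclideanSpace ℝ (Fin d)) :
    charFun μ t = ∑ b ∈ B, (B.card : ℂ)⁻¹ *
      (Complex.exp ((inner ℝ (invMap R (intVec b)) t : ℝ) * Complex.I) *
        charFun μ (star (invMap R) t)) := by
  have := h.isProbabilityMeasure
  have hcard : (B.card : ℝ≥0∞) ≠ 0 := by simpa using hB.ne_empty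
  have hpm : ∀ b, IsProbabilityMeasure (μ.map (ifsMap R b)) := fun b =>
    Measure.isProbabilityMeasure_map (continuous_ifsMap R b).measurable.aemeasurable
  have hint : ∀ ν : Measure (EuclideanSpace ℝ (Fin d)), IsProbabilityMeasure ν →
      Integrable (fun x => Complex.exp ((inner ℝ x t : ℝ) * Complex.I)) ν := by
    intro ν hν
    refine Integrable.of_bound (C := 1) ?_ (Filter.Eventually.of_forall fun x => ?_)
    · exact Continuous.aestronglyMeasurable (by fun_prop)
    · rw [Complex.norm_exp_ofReal_mul_I]
  conv_lhs => rw [h.eq_sum_map]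
  rw [charFun_apply, integral_finsetSum_measure]
  · refine Finset.sum_congr rfl fun b _ => ?_
    rw [integral_smul_measure, integral_map (continuous_ifsMap R b).measurable.aemeasurable
      (hint _ (hpm b)).1, charFun_apply, ← integral_const_mul, Complex.real_smul]
    congr 1
    · simp
    · refine integral_congr_ae (Filter.Eventually.of_forall fun x => ?_)
      simp only
      rw [← Complex.exp_add, ← add_mul, ← Complex.ofReal_add, ContinuousLinearMap.star_eq_adjoint,
        ContinuousLinearMap.adjoint_inner_right, ← inner_add_left, ifsMap, map_add, add_comm]
  · intro b _
    exact (hint _ (hpm b)).smul_measure (by simpa using hcard)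

theorem IsSelfAffineMeasure.unique {d : ℕ} {R : Matrix (Fin d) (Fin d) ℤ}
    (hR : IsExpansive R) {B : Finset (Fin d → ℤ)} (hB : B.Nonempty)
    {μ ν : Measure (EuclideanSpace ℝ (Fin d))}
    (hμ : IsSelfAffineMeasure R B μ) (hν : IsSelfAffineMeasure R B ν) : μ = ν := by
  have := hμ.isProbabilityMeasure
  have := hν.isProbabilityMeasure
  have hcard : (0 : ℝ) < B.card := by exact_mod_cast hB.card_pos
  have hstep : ∀ t, ‖charFun μ t - charFun ν t‖ ≤
      ‖charFun μ (star (invMap R) t) - charFun ν (star (invMap R) t)‖ := by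
    intro t
    rw [hμ.charFun_eq hB t, hν.charFun_eq hB t, ← Finset.sum_sub_distrib]
    refine (norm_sum_le_of_le B (f := fun b => _)
      (n := fun _ => (B.card : ℝ)⁻¹ *
        ‖charFun μ (star (invMap R) t) - charFun ν (star (invMap R) t)‖) ?_).trans ?_
    · intro b _
      rw [← mul_sub, ← mul_sub, norm_mul, norm_mul, Complex.norm_exp_ofReal_mul_I, one_mul,
        norm_inv, Complex.norm_natCast]
    · rw [Finset.sum_const, nsmul_eq_mul, ← mul_assoc, mul_inv_cancel₀ hcard.ne', one_mul]
  have hiter : ∀ (n : ℕ) t, ‖charFun μ t - charFun ν t‖ ≤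
      ‖charFun μ ((star (invMap R) ^ n) t) - charFun ν ((star (invMap R) ^ n) t)‖ := by
    intro n
    induction n with
    | zero => intro t; simp
    | succ n ih =>
      intro t
      refine (hstep t).trans ((ih _).trans ?_)
      rw [pow_succ]; rfl
  apply Measure.ext_of_charFun
  funext t
  have hlim : Filter.Tendsto (fun n : ℕ => (star (invMap R) ^ n) t) Filter.atTop (nhds 0) := by
    have h0 := (summable_norm_pow_of_expansive hR).tendsto_atTop_zero.mul_const ‖t‖
    rw [zero_mul] at h0
    refine squeeze_zero_norm (fun n => ?_) h0
    refine (ContinuousLinearMap.le_opNorm _ _).trans (le_of_eq ?_)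
    rw [← star_pow, ContinuousLinearMap.star_eq_adjoint, LinearIsometryEquiv.norm_map]
  have hc : Continuous fun s => ‖charFun μ s - charFun ν s‖ :=
    (continuous_charFun.sub continuous_charFun).norm
  have h1 := (hc.tendsto 0).comp hlim
  simp only [charFun_zero, probReal_univ, sub_self, norm_zero] at h1
  have h2 : ‖charFun μ t - charFun ν t‖ ≤ 0 :=
    ge_of_tendsto h1 (Filter.Eventually.of_forall fun n => hiter n t)
  exact sub_eq_zero.1 (norm_le_zero_iff.1 h2)

theorem map_cons_infinitePi {α : Type*} [MeasurableSpace α] (P : Measure α)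
    [IsProbabilityMeasure P] :
    (P.prod (Measure.infinitePi fun _ : ℕ => P)).map
      (fun p : α × (ℕ → α) => fun n : ℕ => Nat.casesOn n p.1 p.2) =
    Measure.infinitePi fun _ : ℕ => P := by
  have hmeas : Measurable
      (fun p : α × (ℕ → α) => fun n : ℕ => (Nat.casesOn n p.1 p.2 : α)) := by
    refine measurable_pi_iff.2 fun n => ?_
    cases n with
    | zero => exact measurable_fst
    | succ n => exact (measurable_pi_apply n).comp measurable_snd
  refine Measure.eq_infinitePi (fun _ : ℕ => P) fun s t ht => ?_
  classical
  rw [Measure.map_apply hmeas (MeasurableSet.pi s.countable_toSet fun i _ => ht i)]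
  have hset : (fun p : α × (ℕ → α) => fun n : ℕ => (Nat.casesOn n p.1 p.2 : α)) ⁻¹'
      (Set.pi s t) = (if 0 ∈ s then t 0 else Set.univ) ×ˢ
        Set.pi (s.preimage Nat.succ (Nat.succ_injective.injOn) : Finset ℕ)
          (fun n => t (n + 1)) := by
    ext ⟨a, w⟩
    simp only [Set.mem_preimage, Set.mem_pi, Finset.mem_coe, Set.mem_prod,
      Finset.mem_preimage]
    constructor
    · intro h
      refine ⟨?_, fun n hn => h (n + 1) hn⟩
      split_ifs with h0
      · exact h 0 h0
      · trivial
    · rintro ⟨h0, h1⟩ n hn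
      cases n with
      | zero => simpa [hn] using h0
      | succ n => exact h1 n hn
  rw [hset, Measure.prod_prod, Measure.infinitePi_pi _ fun i _ => ht (i + 1),
    Finset.prod_preimage' Nat.succ s (Nat.succ_injective.injOn) (fun n => P (t n))]
  by_cases h0 : 0 ∈ s
  · rw [if_pos h0, ← Finset.mul_prod_erase s _ h0]
    congr 1
    refine Finset.prod_congr ?_ fun _ _ => rfl
    ext n
    cases n <;> simp
  · rw [if_neg h0, measure_univ, one_mul]
    refine Finset.prod_congr ?_ fun _ _ => rfl
    ext n
    cases n with
    | zero => simp [h0]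
    | succ n => simp

theorem exists_isSelfAffineMeasure {d : ℕ} {R : Matrix (Fin d) (Fin d) ℤ}
    (hR : IsExpansive R) {B : Finset (Fin d → ℤ)} (hB : B.Nonempty) :
    ∃ μ, IsSelfAffineMeasure R B μ := by
  have : Nonempty B := hB.to_subtype
  let P : Measure B := uniformOn Set.univ
  have : IsProbabilityMeasure P := instIsProbabilityMeasure_uniformOn_univ
  let Q : Measure (ℕ → B) := Measure.infinitePi fun _ : ℕ => P
  let f := invMap R
  obtain ⟨C, hC⟩ : ∃ C : ℝ, ∀ b : B, ‖intVec b.1‖ ≤ C := by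
    obtain ⟨C, hC⟩ := (Set.finite_range fun b : B => ‖intVec b.1‖).bddAbove
    exact ⟨C, fun b => hC ⟨b, rfl⟩⟩
  let S : (ℕ → B) → EuclideanSpace ℝ (Fin d) := fun w => ∑' k : ℕ, (f ^ (k + 1)) (intVec (w k).1)
  have hbound : ∀ (k : ℕ) (b : B), ‖(f ^ (k + 1)) (intVec b.1)‖ ≤ ‖f ^ (k + 1)‖ * C := fun k b =>
    (ContinuousLinearMap.le_opNorm _ _).trans
      (mul_le_mul_of_nonneg_left (hC b) (norm_nonneg _))
  have hsumC : Summable fun k : ℕ => ‖f ^ (k + 1)‖ * C :=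
    (((summable_nat_add_iff 1).2 (summable_norm_pow_of_expansive hR))).mul_right C
  have hsum : ∀ w : ℕ → B, Summable fun k : ℕ => (f ^ (k + 1)) (intVec (w k).1) := fun w =>
    Summable.of_norm_bounded hsumC fun k => hbound k (w k)
  have hS : Measurable S := by
    refine measurable_of_tendsto_metrizable
      (f := fun n (w : ℕ → B) => ∑ k ∈ Finset.range n, (f ^ (k + 1)) (intVec (w k).1)) ?_ ?_
    · intro n
      refine Finset.measurable_sum _ fun k _ => ?_
      exact (measurable_of_countable fun b : B => (f ^ (k + 1)) (intVec b.1)).comp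
        (measurable_pi_apply k)
    · rw [tendsto_pi_nhds]
      exact fun w => (hsum w).hasSum.tendsto_sum_nat
  have hcons : ∀ (b : B) (w : ℕ → B),
      S (fun n : ℕ => Nat.casesOn n b w) = ifsMap R b.1 (S w) := by
    intro b w
    have h1 := (hsum (fun n : ℕ => Nat.casesOn n b w)).tsum_eq_zero_add
    change S _ = _ at h1
    rw [h1, ifsMap, map_add, add_comm]
    congr 1
    change _ = f (∑' k : ℕ, (f ^ (k + 1)) (intVec (w k).1))
    rw [f.map_tsum (hsum w)]
    refine tsum_congr fun k => ?_
    change (f ^ (k + 1 + 1)) (intVec (w k).1) = _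
    rw [pow_succ' f (k + 1)]; rfl
  refine ⟨Q.map S, Measure.isProbabilityMeasure_map hS.aemeasurable, fun E hE => ?_⟩
  have hmeas : Measurable
      (fun p : B × (ℕ → B) => fun n : ℕ => (Nat.casesOn n p.1 p.2 : B)) := by
    refine measurable_pi_iff.2 fun n => ?_
    cases n with
    | zero => exact measurable_fst
    | succ n => exact (measurable_pi_apply n).comp measurable_snd
  rw [Measure.map_apply hS hE]
  have hQ : Q (S ⁻¹' E) = (P.prod Q).map
      (fun p : B × (ℕ → B) => fun n : ℕ => (Nat.casesOn n p.1 p.2 : B)) (S ⁻¹' E) := by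
    rw [map_cons_infinitePi P]
  rw [hQ, Measure.map_apply hmeas (hS hE), Measure.prod_apply (hmeas (hS hE)),
    lintegral_fintype, ← Finset.sum_coe_sort B]
  refine Finset.sum_congr rfl fun b _ => ?_
  have hPb : P {b} = (B.card : ℝ≥0∞)⁻¹ := by
    simp [P, uniformOn_univ]
  rw [hPb, mul_comm, Measure.map_apply hS ((continuous_ifsMap R b.1).measurable hE)]
  congr 2
  ext w
  simp only [Set.mem_preimage]
  rw [hcons b w]

/-- For `R` expansive and `B` nonempty, `μ(R, B)` has the defining property ... -/
theorem isSelfAffineMeasure_selfAffineMeasure {d : ℕ} {R : Matrix (Fin d) (Fin d) ℤ}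
    (hR : IsExpansive R) {B : Finset (Fin d → ℤ)} (hB : B.Nonempty) :
    IsSelfAffineMeasure R B (selfAffineMeasure R B) := by
  have h := exists_isSelfAffineMeasure hR hB
  rw [selfAffineMeasure, dif_pos h]
  exact h.choose_spec

/-- ... and is the only measure that has it. -/
theorem IsSelfAffineMeasure.eq_selfAffineMeasure {d : ℕ} {R : Matrix (Fin d) (Fin d) ℤ}
    (hR : IsExpansive R) {B : Finset (Fin d → ℤ)} (hB : B.Nonempty)
    {μ : Measure (EuclideanSpace ℝ (Fin d))} (hμ : IsSelfAffineMeasure R B μ) :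
    μ = selfAffineMeasure R B :=
  hμ.unique hR hB (isSelfAffineMeasure_selfAffineMeasure hR hB)

/-!
Write `T = (Rᵀ)⁻¹`, `m_B(ξ) = (1/N) ∑_{b ∈ B} exp(-2πi⟨ξ, b⟩)` and
`M_n(ξ) = m_B(Tξ) ⋯ m_B(Tⁿξ)`. Invariance of `μ` gives `μ̂(ξ) = M_n(ξ) μ̂(Tⁿξ)`, and `M_n → μ̂`
pointwise because `Tⁿ → 0`. By Parseval's identity and the totality of the exponentials in `L²(μ)`,
a countable set `Λ` is a spectrum of `μ` exactly if distinct elements differ by zeros of `μ̂` and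
`∑_{λ ∈ Λ} |μ̂(ξ + λ)|² = 1` for all `ξ` (`IsSpectrum.hasSum`, `isSpectrum_of_hasSum`). In
particular, the translates `μ̂(ξ + λ)` along an integral spectrum cannot all vanish, so the periodic
zero set is empty.

For the converse, call a finite `Λ ⊆ ℤᵈ` a spectrum of level `n` if
`∑_{λ ∈ Λ} |M_n(ξ + λ)|² = 1` for all `ξ`. The Hadamard condition says that `L` is a spectrum of
level one. If `Λ` has level `m` and `J` has level `p`, then `Λ + (Rᵀ)ᵐ J` has level `m + p`, and
the points of `J` may be moved by elements of `(Rᵀ)ᵖ ℤᵈ`, since `M_p` is periodic under that lattice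
(`IsLevelSpectrum.compose`). If the periodic zero set is empty, then compactness of the unit cube
yields `ε, δ > 0` such that every point `x` has a translate `x + k`, `k ∈ ℤᵈ`, with `|μ̂| ≥ ε` on the
`δ`-ball around it (`exists_uniform_bound`). Moving each `j ∈ J` by the `k` that belongs to `x = Tᵖj`
makes the tails `|μ̂(T^(m + p)(ξ + λ))|` at least `ε` on the new spectrum, once `p` is large
(`IsHadamardTriple.exists_isLevelSpectrum_superset`).

Iteration gives an increasing sequence of level spectra with union `Λ`. The relation
`μ̂ = M_n · μ̂(Tⁿ ·)` shows that distinct elements of `Λ` differ by zeros of `μ̂`, and on the `n`-th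
set it bounds the square of the partial product at `ξ + λ` by `ε⁻² |μ̂(ξ + λ)|²`, which is summable
over `Λ` by Bessel's inequality. Dominated convergence turns the identities for the levels into
`∑_{λ ∈ Λ} |μ̂(ξ + λ)|² = 1` (`IsSelfAffineMeasure.isSpectrum_of_tower`).
-/

/-! ### Exponentials in `L²(μ)` -/

/-- If Bessel's inequality for the orthonormal family `v` is an equality at `x`, then `x` lies in
the closed span of `v`; here in the form that `x` is orthogonal to everything that `v` is
orthogonal to. -/
theorem Orthonormal.inner_eq_zero_of_hasSum_norm_sq {ι H : Type*} [NormedAddCommGroup H]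
    [InnerProductSpace ℂ H] {v : ι → H} (hv : Orthonormal ℂ v) {x f : H}
    (hx : HasSum (fun i => ‖inner ℂ (v i) x‖ ^ 2) (‖x‖ ^ 2)) (hf : ∀ i, inner ℂ (v i) f = 0) :
    inner ℂ x f = 0 := by
  by_cases hf0 : f = 0
  · simp [hf0]
  have hn : ‖f‖ ≠ 0 := norm_ne_zero_iff.2 hf0
  -- Bessel's inequality for the family `v` enlarged by the normalization of `f`.
  let w : Option ι → H := fun o => o.elim (((‖f‖ : ℂ)⁻¹) • f) v
  have hw : Orthonormal ℂ w := by
    refine ⟨?_, ?_⟩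
    · rintro (_ | i)
      · simp [w, norm_smul, hn]
      · exact hv.1 i
    · rintro (_ | i) (_ | j) hij
      · exact absurd rfl hij
      · simp [w, inner_smul_left, inner_eq_zero_symm.1 (hf j)]
      · simp [w, inner_smul_right, hf i]
      · exact hv.2 fun h => hij (congrArg some h)
  have hle : ‖x‖ ^ 2 ≤ ‖x‖ ^ 2 - ‖inner ℂ (w none) x‖ ^ 2 := by
    refine hasSum_le_of_sum_le hx fun s => ?_
    have := hw.sum_inner_products_le x (s := Finset.insertNone s)
    rw [Finset.sum_insertNone] at this
    simp only [w, Option.elim] at this ⊢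
    linarith
  have h0 : inner ℂ (w none) x = 0 := by
    rw [← norm_eq_zero, ← sq_eq_zero_iff]
    exact le_antisymm (by linarith) (sq_nonneg _)
  rw [inner_eq_zero_symm]
  simpa [w, inner_smul_left, hn] using h0

variable {d : ℕ}

theorem norm_exp_two_pi_inner (ξ x : EuclideanSpace ℝ (Fin d)) :
    ‖Complex.exp (2 * Real.pi * Complex.I * ((inner ℝ ξ x : ℝ) : ℂ))‖ = 1 := by
  rw [show 2 * (Real.pi : ℂ) * Complex.I * ((inner ℝ ξ x : ℝ) : ℂ)
    = ((2 * Real.pi * inner ℝ ξ x : ℝ) : ℂ) * Complex.I by push_cast; ring,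
    Complex.norm_exp_ofReal_mul_I]

theorem memLp_exp (μ : Measure (EuclideanSpace ℝ (Fin d))) [IsFiniteMeasure μ]
    (ξ : EuclideanSpace ℝ (Fin d)) :
    MemLp (fun x => Complex.exp (2 * Real.pi * Complex.I * ((inner ℝ ξ x : ℝ) : ℂ))) 2 μ :=
  MemLp.of_bound (Continuous.aestronglyMeasurable (by fun_prop)) 1
    (Filter.Eventually.of_forall fun x => (norm_exp_two_pi_inner ξ x).le)

/-- The exponential `x ↦ exp(2πi⟨ξ, x⟩)` as an element of `L²(μ)`. -/
noncomputable def expLp (μ : Measure (EuclideanSpace ℝ (Fin d))) [IsFiniteMeasure μ]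
    (ξ : EuclideanSpace ℝ (Fin d)) : Lp ℂ 2 μ :=
  (memLp_exp μ ξ).toLp _

theorem coeFn_expLp (μ : Measure (EuclideanSpace ℝ (Fin d))) [IsFiniteMeasure μ]
    (ξ : EuclideanSpace ℝ (Fin d)) :
    expLp μ ξ =ᵐ[μ] fun x => Complex.exp (2 * Real.pi * Complex.I * ((inner ℝ ξ x : ℝ) : ℂ)) :=
  (memLp_exp μ ξ).coeFn_toLp

theorem conj_exp_two_pi_inner (ξ x : EuclideanSpace ℝ (Fin d)) :
    (starRingEnd ℂ) (Complex.exp (2 * Real.pi * Complex.I * ((inner ℝ ξ x : ℝ) : ℂ))) =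
      Complex.exp (-(2 * Real.pi * Complex.I * ((inner ℝ ξ x : ℝ) : ℂ))) := by
  rw [← Complex.exp_conj]
  simp only [map_mul, map_ofNat, Complex.conj_I, Complex.conj_ofReal, mul_neg, neg_mul]

theorem inner_expLp_left (μ : Measure (EuclideanSpace ℝ (Fin d))) [IsFiniteMeasure μ]
    (ξ : EuclideanSpace ℝ (Fin d)) (f : Lp ℂ 2 μ) :
    inner ℂ (expLp μ ξ) f =
      ∫ x, Complex.exp (-(2 * Real.pi * Complex.I * ((inner ℝ ξ x : ℝ) : ℂ))) * f x ∂μ := by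
  rw [L2.inner_def]
  refine integral_congr_ae ?_
  filter_upwards [coeFn_expLp μ ξ] with x hx
  rw [hx, RCLike.inner_apply, conj_exp_two_pi_inner, mul_comm]

theorem inner_expLp_expLp (μ : Measure (EuclideanSpace ℝ (Fin d))) [IsFiniteMeasure μ]
    (ξ η : EuclideanSpace ℝ (Fin d)) :
    inner ℂ (expLp μ ξ) (expLp μ η) = fourierHat μ (ξ - η) := by
  rw [inner_expLp_left, fourierHat]
  refine integral_congr_ae ?_
  filter_upwards [coeFn_expLp μ η] with x hx
  rw [hx, ← Complex.exp_add, inner_sub_left]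
  congr 1
  push_cast
  ring

theorem fourierHat_zero (μ : Measure (EuclideanSpace ℝ (Fin d))) [IsProbabilityMeasure μ] :
    fourierHat μ 0 = 1 := by
  simp [fourierHat]

theorem norm_expLp (μ : Measure (EuclideanSpace ℝ (Fin d))) [IsProbabilityMeasure μ]
    (ξ : EuclideanSpace ℝ (Fin d)) : ‖expLp μ ξ‖ = 1 := by
  rw [← pow_eq_one_iff_of_nonneg (norm_nonneg _) two_ne_zero, @norm_sq_eq_re_inner ℂ,
    inner_expLp_expLp, sub_self, fourierHat_zero, RCLike.one_re]

/-- A real integrable function whose Fourier transform vanishes is zero: the measures with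
densities its positive and its negative part have the same characteristic function. -/
theorem ae_eq_zero_of_integral_exp_mul_eq_zero {μ : Measure (EuclideanSpace ℝ (Fin d))}
    [IsFiniteMeasure μ] {g : EuclideanSpace ℝ (Fin d) → ℝ} (hg : Integrable g μ)
    (h : ∀ t, ∫ x, Complex.exp ((inner ℝ x t : ℝ) * Complex.I) * (g x : ℂ) ∂μ = 0) :
    g =ᵐ[μ] 0 := by
  have hchar : ∀ u : EuclideanSpace ℝ (Fin d) → ℝ, Integrable u μ → ∀ t,
      charFun (μ.withDensity fun x => ENNReal.ofReal (u x)) t =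
        ∫ x, Complex.exp ((inner ℝ x t : ℝ) * Complex.I) * ((max (u x) 0 : ℝ) : ℂ) ∂μ := by
    intro u hu t
    rw [charFun_apply, integral_withDensity_eq_integral_toReal_smul₀
      hu.1.aemeasurable.ennreal_ofReal (Filter.Eventually.of_forall fun _ => ENNReal.ofReal_lt_top)]
    refine integral_congr_ae (Filter.Eventually.of_forall fun x => ?_)
    simp only [ENNReal.toReal_ofReal', Complex.real_smul]
    rw [mul_comm]
  have hint : ∀ u : EuclideanSpace ℝ (Fin d) → ℝ, Integrable u μ → ∀ t,
      Integrable (fun x => Complex.exp ((inner ℝ x t : ℝ) * Complex.I) *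
        ((max (u x) 0 : ℝ) : ℂ)) μ := by
    intro u hu t
    refine hu.pos_part.ofReal.bdd_mul (c := 1) (Continuous.aestronglyMeasurable (by fun_prop))
      (Filter.Eventually.of_forall fun x => ?_)
    rw [Complex.norm_exp_ofReal_mul_I]
  have hfin : ∀ u : EuclideanSpace ℝ (Fin d) → ℝ, Integrable u μ →
      IsFiniteMeasure (μ.withDensity fun x => ENNReal.ofReal (u x)) := fun u hu =>
    isFiniteMeasure_withDensity_ofReal hu.2
  have := hfin g hg
  have := hfin (fun x => -g x) hg.neg
  have heq : μ.withDensity (fun x => ENNReal.ofReal (g x)) =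
      μ.withDensity (fun x => ENNReal.ofReal (-g x)) := by
    refine Measure.ext_of_charFun (funext fun t => ?_)
    rw [hchar g hg, hchar (fun x => -g x) hg.neg, ← sub_eq_zero, ← integral_sub (hint g hg t)
      (hint (fun x => -g x) hg.neg t), ← h t]
    refine integral_congr_ae (Filter.Eventually.of_forall fun x => ?_)
    simp only
    rw [← mul_sub, ← Complex.ofReal_sub]
    congr 2
    rcases le_total 0 (g x) with h0 | h0
    · rw [max_eq_left h0, max_eq_right (by simpa using h0), sub_zero]
    · rw [max_eq_right h0, max_eq_left (by simpa using h0), zero_sub, neg_neg]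
  have hae := (withDensity_eq_iff_of_sigmaFinite hg.1.aemeasurable.ennreal_ofReal
    hg.neg.1.aemeasurable.ennreal_ofReal).1 heq
  filter_upwards [hae] with x hx
  rcases le_total 0 (g x) with h0 | h0
  · simp only [Pi.neg_apply] at hx
    rw [ENNReal.ofReal_of_nonpos (p := -g x) (by linarith), ENNReal.ofReal_eq_zero] at hx
    exact le_antisymm hx h0
  · rw [ENNReal.ofReal_of_nonpos h0, eq_comm, ENNReal.ofReal_eq_zero] at hx
    exact le_antisymm h0 (by simpa using hx)

/-- The exponentials are total in `L²(μ)`. -/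
theorem eq_zero_of_inner_expLp_eq_zero {μ : Measure (EuclideanSpace ℝ (Fin d))}
    [IsFiniteMeasure μ] {f : Lp ℂ 2 μ} (hf : ∀ ξ, inner ℂ (expLp μ ξ) f = 0) : f = 0 := by
  have hfint : Integrable f μ := (Lp.memLp f).integrable (by norm_num)
  have hF : ∀ t, ∫ x, Complex.exp ((inner ℝ x t : ℝ) * Complex.I) * f x ∂μ = 0 := by
    intro t
    rw [← hf (-(2 * Real.pi)⁻¹ • t), inner_expLp_left]
    refine integral_congr_ae (Filter.Eventually.of_forall fun x => ?_)
    simp only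
    congr 2
    rw [inner_smul_left, real_inner_comm]
    have : (Real.pi : ℂ) ≠ 0 := by exact_mod_cast Real.pi_ne_zero
    simp
    field_simp
  have hFc : ∀ t, ∫ x, Complex.exp ((inner ℝ x t : ℝ) * Complex.I) *
      (starRingEnd ℂ) (f x) ∂μ = 0 := by
    intro t
    rw [← map_zero (starRingEnd ℂ), ← hF (-t), ← integral_conj]
    refine integral_congr_ae (Filter.Eventually.of_forall fun x => ?_)
    simp only [map_mul, ← Complex.exp_conj]
    congr 2
    simp
  have hI : ∀ {u : EuclideanSpace ℝ (Fin d) → ℂ}, Integrable u μ → ∀ t,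
      Integrable (fun x => Complex.exp ((inner ℝ x t : ℝ) * Complex.I) * u x) μ := by
    intro u hu t
    refine hu.bdd_mul (c := 1) (Continuous.aestronglyMeasurable (by fun_prop))
      (Filter.Eventually.of_forall fun x => ?_)
    rw [Complex.norm_exp_ofReal_mul_I]
  have hconj : Integrable (fun x => (starRingEnd ℂ) (f x)) μ :=
    (LinearIsometryEquiv.integrable_comp_iff (Complex.conjLIE)).2 hfint
  have hre : (fun x => (f x).re) =ᵐ[μ] 0 := by
    refine ae_eq_zero_of_integral_exp_mul_eq_zero hfint.re fun t => ?_
    have h2 := congrArg (fun z : ℂ => z / 2) (congrArg₂ (· + ·) (hF t) (hFc t))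
    simp only [add_zero, zero_div] at h2
    rw [← integral_add (hI hfint t) (hI hconj t), ← integral_div] at h2
    rw [← h2]
    refine integral_congr_ae (Filter.Eventually.of_forall fun x => ?_)
    simp only
    rw [← mul_add, Complex.add_conj]
    push_cast
    ring
  have him : (fun x => (f x).im) =ᵐ[μ] 0 := by
    refine ae_eq_zero_of_integral_exp_mul_eq_zero hfint.im fun t => ?_
    have h2 := congrArg (fun z : ℂ => z / (2 * Complex.I)) (congrArg₂ (· - ·) (hF t) (hFc t))
    simp only [sub_zero, zero_div] at h2
    rw [← integral_sub (hI hfint t) (hI hconj t), ← integral_div] at h2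
    rw [← h2]
    refine integral_congr_ae (Filter.Eventually.of_forall fun x => ?_)
    simp only
    rw [← mul_sub, Complex.sub_conj]
    field_simp
    push_cast
    ring
  rw [Lp.eq_zero_iff_ae_eq_zero]
  filter_upwards [hre, him] with x h1 h2
  exact Complex.ext h1 h2

/-- The Jorgensen–Pedersen criterion, one direction: the function `∑_{λ ∈ Λ} |μ̂(ξ + λ)|²` of a
spectrum `Λ` is the constant `1`. -/
theorem IsSpectrum.hasSum {μ : Measure (EuclideanSpace ℝ (Fin d))} [IsProbabilityMeasure μ]
    {Λ : Set (EuclideanSpace ℝ (Fin d))} (h : IsSpectrum μ Λ) (ξ : EuclideanSpace ℝ (Fin d)) :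
    HasSum (fun lam : Λ => ‖fourierHat μ (ξ + lam)‖ ^ 2) 1 := by
  obtain ⟨-, e, he⟩ := h
  have hee : ∀ lam : Λ, e lam = expLp μ lam := fun lam =>
    Lp.ext ((he lam).trans (coeFn_expLp μ _).symm)
  have h1 := e.hasSum_inner_mul_inner (expLp μ (-ξ)) (expLp μ (-ξ))
  rw [inner_self_eq_norm_sq_to_K, norm_expLp] at h1
  have h2 := Complex.hasSum_re h1
  convert h2 using 1
  · funext lam
    rw [hee, ← inner_conj_symm, inner_expLp_expLp, sub_neg_eq_add, add_comm,
      ← Complex.normSq_eq_conj_mul_self, Complex.ofReal_re, Complex.normSq_eq_norm_sq]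
  · simp

/-- The Jorgensen–Pedersen criterion, the other direction. -/
theorem isSpectrum_of_hasSum {μ : Measure (EuclideanSpace ℝ (Fin d))} [IsProbabilityMeasure μ]
    {Λ : Set (EuclideanSpace ℝ (Fin d))} (hΛ : Λ.Countable)
    (horth : ∀ lam ∈ Λ, ∀ lam' ∈ Λ, lam ≠ lam' → fourierHat μ (lam - lam') = 0)
    (h : ∀ ξ, HasSum (fun lam : Λ => ‖fourierHat μ (ξ + lam)‖ ^ 2) 1) : IsSpectrum μ Λ := by
  have hv : Orthonormal ℂ fun lam : Λ => expLp μ lam := by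
    refine ⟨fun lam => norm_expLp μ _, fun lam lam' hne => ?_⟩
    change inner ℂ (expLp μ lam) (expLp μ lam') = 0
    rw [inner_expLp_expLp]
    exact horth _ lam.2 _ lam'.2 fun h => hne (Subtype.ext h)
  have hsp : (Submodule.span ℂ (Set.range fun lam : Λ => expLp μ lam))ᗮ = ⊥ := by
    rw [Submodule.eq_bot_iff]
    intro f hf
    refine eq_zero_of_inner_expLp_eq_zero fun ξ => ?_
    refine hv.inner_eq_zero_of_hasSum_norm_sq ?_ fun lam =>
      (Submodule.mem_orthogonal _ _).1 hf _ (Submodule.subset_span ⟨lam, rfl⟩)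
    rw [norm_expLp, one_pow]
    convert h (-ξ) using 3 with lam
    rw [inner_expLp_expLp, sub_eq_neg_add]
  refine ⟨hΛ, HilbertBasis.mkOfOrthogonalEqBot hv hsp, fun lam => ?_⟩
  rw [HilbertBasis.coe_mkOfOrthogonalEqBot]
  exact coeFn_expLp μ _

/-! ### Integer vectors and the dual expansion -/

theorem intVec_zero : intVec (0 : Fin d → ℤ) = 0 := by
  ext i; simp [intVec]

theorem intVec_add (k l : Fin d → ℤ) : intVec (k + l) = intVec k + intVec l := by
  ext i; simp [intVec]

theorem intVec_neg (k : Fin d → ℤ) : intVec (-k) = -intVec k := by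
  ext i; simp [intVec]

theorem intVec_injective : Function.Injective (intVec (d := d)) := by
  intro k l h
  funext i
  have := congrArg (fun v : EuclideanSpace ℝ (Fin d) => v i) h
  simpa [intVec] using this

theorem inner_intVec (k l : Fin d → ℤ) :
    inner ℝ (intVec k) (intVec l) = ((k ⬝ᵥ l : ℤ) : ℝ) := by
  simp [intVec, PiLp.inner_apply, dotProduct, mul_comm]

theorem IsExpansive.isUnit_det {R : Matrix (Fin d) (Fin d) ℤ} (hR : IsExpansive R) :
    IsUnit (R.map (Int.cast : ℤ → ℝ)).det := by
  have h1 : IsUnit (R.map (Int.cast : ℤ → ℂ)) := by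
    by_contra h
    have h2 := hR 0 (by
      rw [Module.End.hasEigenvalue_iff_mem_spectrum, Matrix.spectrum_toLin']
      exact (spectrum.zero_mem_iff ℂ).2 h)
    simp at h2
    linarith
  have h2 := (Matrix.isUnit_iff_isUnit_det _).1 h1
  rw [isUnit_iff_ne_zero] at h2 ⊢
  have h3 : (R.map (Int.cast : ℤ → ℂ)).det = (R.det : ℂ) :=
    ((Int.castRingHom ℂ).map_det R).symm
  have h4 : (R.map (Int.cast : ℤ → ℝ)).det = (R.det : ℝ) :=
    ((Int.castRingHom ℝ).map_det R).symm
  rw [h3] at h2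
  rw [h4]
  exact_mod_cast h2

theorem star_invMap_intVec {R : Matrix (Fin d) (Fin d) ℤ} (hR : IsExpansive R)
    (k : Fin d → ℤ) : star (invMap R) (intVec (R.transpose.mulVec k)) = intVec k := by
  rw [invMap, ← map_star]
  ext i
  change ((star (R.map (Int.cast : ℤ → ℝ))⁻¹).mulVec
    (fun i => ((R.transpose.mulVec k i : ℤ) : ℝ))) i = (k i : ℝ)
  have h1 : (fun i => ((R.transpose.mulVec k i : ℤ) : ℝ)) =
      (R.map (Int.cast : ℤ → ℝ)).transpose.mulVec fun i => (k i : ℝ) := by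
    funext i
    simp [Matrix.mulVec, dotProduct]
  rw [h1, Matrix.star_eq_conjTranspose, Matrix.conjTranspose_eq_transpose_of_trivial,
    Matrix.mulVec_mulVec, ← Matrix.transpose_mul, Matrix.mul_nonsing_inv _ hR.isUnit_det,
    Matrix.transpose_one, Matrix.one_mulVec]

theorem star_invMap_pow_intVec {R : Matrix (Fin d) (Fin d) ℤ} (hR : IsExpansive R) (n : ℕ)
    (k : Fin d → ℤ) :
    (star (invMap R) ^ n) (intVec ((R.transpose ^ n).mulVec k)) = intVec k := by
  induction n with
  | zero => simp
  | succ n ih =>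
    rw [pow_succ, pow_succ', ← Matrix.mulVec_mulVec]
    change (star (invMap R) ^ n) (star (invMap R) _) = _
    rw [star_invMap_intVec hR, ih]

theorem tendsto_star_invMap_pow {R : Matrix (Fin d) (Fin d) ℤ} (hR : IsExpansive R)
    (t : EuclideanSpace ℝ (Fin d)) :
    Filter.Tendsto (fun n : ℕ => (star (invMap R) ^ n) t) Filter.atTop (nhds 0) := by
  have h0 := (summable_norm_pow_of_expansive hR).tendsto_atTop_zero.mul_const ‖t‖
  rw [zero_mul] at h0
  refine squeeze_zero_norm (fun n => ?_) h0
  refine (ContinuousLinearMap.le_opNorm _ _).trans (le_of_eq ?_)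
  rw [← star_pow, ContinuousLinearMap.star_eq_adjoint, LinearIsometryEquiv.norm_map]

/-! ### The infinite product for `μ̂` -/

/-- The mask `m_B(ξ) = (1/N) ∑_{b ∈ B} exp(-2πi⟨ξ, b⟩)`. -/
noncomputable def maskFun (B : Finset (Fin d → ℤ)) (ξ : EuclideanSpace ℝ (Fin d)) : ℂ :=
  (B.card : ℂ)⁻¹ * ∑ b ∈ B,
    Complex.exp (-(2 * Real.pi * Complex.I * ((inner ℝ ξ (intVec b) : ℝ) : ℂ)))

/-- The partial products `∏_{j = 1}^n m_B((Rᵀ)⁻ʲ ξ)` of `μ̂(ξ)`, where `(Rᵀ)⁻¹` is the adjoint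
of `R⁻¹`. -/
noncomputable def partialHat (R : Matrix (Fin d) (Fin d) ℤ) (B : Finset (Fin d → ℤ)) (n : ℕ)
    (ξ : EuclideanSpace ℝ (Fin d)) : ℂ :=
  ∏ j ∈ Finset.range n, maskFun B ((star (invMap R) ^ (j + 1)) ξ)

theorem maskFun_zero {B : Finset (Fin d → ℤ)} (hB : B.Nonempty) : maskFun B 0 = 1 := by
  have : (B.card : ℂ) ≠ 0 := by exact_mod_cast hB.card_pos.ne'
  simp [maskFun, this]

theorem maskFun_add_intVec (B : Finset (Fin d → ℤ)) (ξ : EuclideanSpace ℝ (Fin d))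
    (k : Fin d → ℤ) : maskFun B (ξ + intVec k) = maskFun B ξ := by
  unfold maskFun
  congr 1
  refine Finset.sum_congr rfl fun b _ => ?_
  rw [inner_add_left, inner_intVec, ← Complex.exp_periodic.int_mul (k ⬝ᵥ b) (-(_ : ℂ))]
  congr 1
  push_cast
  ring

theorem partialHat_zero_right (R : Matrix (Fin d) (Fin d) ℤ) {B : Finset (Fin d → ℤ)}
    (hB : B.Nonempty) (n : ℕ) : partialHat R B n 0 = 1 := by
  simp [partialHat, maskFun_zero hB]

theorem partialHat_one (R : Matrix (Fin d) (Fin d) ℤ) (B : Finset (Fin d → ℤ))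
    (ξ : EuclideanSpace ℝ (Fin d)) : partialHat R B 1 ξ = maskFun B (star (invMap R) ξ) := by
  simp [partialHat]

theorem partialHat_add (R : Matrix (Fin d) (Fin d) ℤ) (B : Finset (Fin d → ℤ)) (m p : ℕ)
    (ξ : EuclideanSpace ℝ (Fin d)) :
    partialHat R B (m + p) ξ = partialHat R B m ξ * partialHat R B p ((star (invMap R) ^ m) ξ) := by
  rw [partialHat, Finset.prod_range_add, partialHat, partialHat]
  congr 1
  refine Finset.prod_congr rfl fun j _ => ?_
  rw [show m + j + 1 = (j + 1) + m by ring, pow_add _ (j + 1) m]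
  rfl

theorem partialHat_add_intVec {R : Matrix (Fin d) (Fin d) ℤ} (hR : IsExpansive R)
    (B : Finset (Fin d → ℤ)) (n : ℕ) (ξ : EuclideanSpace ℝ (Fin d)) (k : Fin d → ℤ) :
    partialHat R B n (ξ + intVec ((R.transpose ^ n).mulVec k)) = partialHat R B n ξ := by
  refine Finset.prod_congr rfl fun j hj => ?_
  obtain ⟨q, rfl⟩ := Nat.exists_eq_add_of_le (Finset.mem_range.1 hj)
  rw [map_add, pow_add R.transpose, ← Matrix.mulVec_mulVec, Nat.succ_eq_add_one,
    star_invMap_pow_intVec hR, maskFun_add_intVec]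

theorem fourierHat_eq_charFun (μ : Measure (EuclideanSpace ℝ (Fin d)))
    (ξ : EuclideanSpace ℝ (Fin d)) : fourierHat μ ξ = charFun μ (-(2 * Real.pi) • ξ) := by
  rw [fourierHat, charFun_apply]
  refine integral_congr_ae (Filter.Eventually.of_forall fun x => ?_)
  simp only
  rw [inner_smul_right, real_inner_comm]
  congr 1
  push_cast
  ring

theorem continuous_fourierHat (μ : Measure (EuclideanSpace ℝ (Fin d))) [IsFiniteMeasure μ] :
    Continuous (fourierHat μ) := by
  have : fourierHat μ = fun ξ => charFun μ (-(2 * Real.pi) • ξ) :=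
    funext fun ξ => fourierHat_eq_charFun μ ξ
  rw [this]
  exact continuous_charFun.comp (by fun_prop)

theorem IsSelfAffineMeasure.fourierHat_eq {R : Matrix (Fin d) (Fin d) ℤ}
    {B : Finset (Fin d → ℤ)} (hB : B.Nonempty) {μ : Measure (EuclideanSpace ℝ (Fin d))}
    (h : IsSelfAffineMeasure R B μ) (ξ : EuclideanSpace ℝ (Fin d)) :
    fourierHat μ ξ = maskFun B (star (invMap R) ξ) * fourierHat μ (star (invMap R) ξ) := by
  rw [fourierHat_eq_charFun, fourierHat_eq_charFun, h.charFun_eq hB, maskFun, Finset.mul_sum,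
    Finset.sum_mul]
  refine Finset.sum_congr rfl fun b _ => ?_
  rw [map_smul, ← mul_assoc]
  congr 3
  rw [inner_smul_right, ContinuousLinearMap.star_eq_adjoint,
    ContinuousLinearMap.adjoint_inner_left, real_inner_comm]
  push_cast
  ring

theorem IsSelfAffineMeasure.fourierHat_eq_partialHat_mul {R : Matrix (Fin d) (Fin d) ℤ}
    {B : Finset (Fin d → ℤ)} (hB : B.Nonempty) {μ : Measure (EuclideanSpace ℝ (Fin d))}
    (h : IsSelfAffineMeasure R B μ) (n : ℕ) (ξ : EuclideanSpace ℝ (Fin d)) :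
    fourierHat μ ξ = partialHat R B n ξ * fourierHat μ ((star (invMap R) ^ n) ξ) := by
  induction n with
  | zero => simp [partialHat]
  | succ n ih =>
    rw [ih, h.fourierHat_eq hB, partialHat_add, partialHat_one, pow_succ' _ n, mul_assoc]
    rfl

theorem IsSelfAffineMeasure.tendsto_partialHat {R : Matrix (Fin d) (Fin d) ℤ}
    (hR : IsExpansive R) {B : Finset (Fin d → ℤ)} (hB : B.Nonempty)
    {μ : Measure (EuclideanSpace ℝ (Fin d))} (h : IsSelfAffineMeasure R B μ)
    (ξ : EuclideanSpace ℝ (Fin d)) :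
    Filter.Tendsto (fun n => partialHat R B n ξ) Filter.atTop (nhds (fourierHat μ ξ)) := by
  have := h.isProbabilityMeasure
  have h1 : Filter.Tendsto (fun n : ℕ => fourierHat μ ((star (invMap R) ^ n) ξ)) Filter.atTop
      (nhds 1) := by
    rw [← fourierHat_zero μ]
    exact ((continuous_fourierHat μ).tendsto 0).comp (tendsto_star_invMap_pow hR ξ)
  have h2 := (tendsto_const_nhds (x := fourierHat μ ξ)).div h1 one_ne_zero
  rw [div_one] at h2
  refine h2.congr' ?_
  filter_upwards [h1.eventually_ne one_ne_zero] with n hn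
  rw [Pi.div_apply, div_eq_iff hn]
  exact h.fourierHat_eq_partialHat_mul hB n ξ

/-! ### Spectra of the finite levels -/

/-- `Λ` is a spectrum of level `n`: `∑_{λ ∈ Λ} |∏_{j = 1}^n m_B((Rᵀ)⁻ʲ (ξ + λ))|² = 1` for all `ξ`.
Equivalently, `Λ` is a spectrum of the distribution of `R⁻¹ b₁ + ⋯ + R⁻ⁿ bₙ` with the `bᵢ`
independent and uniform on `B`, whose Fourier transform is `partialHat R B n`. -/
def IsLevelSpectrum (R : Matrix (Fin d) (Fin d) ℤ) (B : Finset (Fin d → ℤ)) (n : ℕ)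
    (Λ : Finset (Fin d → ℤ)) : Prop :=
  ∀ ξ, ∑ lam ∈ Λ, ‖partialHat R B n (ξ + intVec lam)‖ ^ 2 = 1

/-- Evaluating the defining sum at `-λ` makes the term of `λ` equal to `1`, so the others
vanish. -/
theorem partialHat_sub_eq_zero_of_sum_eq_one {R : Matrix (Fin d) (Fin d) ℤ}
    {B : Finset (Fin d → ℤ)} (hB : B.Nonempty) {n : ℕ} {ι : Type*} {s : Finset ι}
    {f : ι → Fin d → ℤ} (h : ∀ ξ, ∑ i ∈ s, ‖partialHat R B n (ξ + intVec (f i))‖ ^ 2 = 1)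
    {i j : ι} (hi : i ∈ s) (hj : j ∈ s) (hij : i ≠ j) :
    partialHat R B n (intVec (f i) - intVec (f j)) = 0 := by
  classical
  have h1 := h (-intVec (f j))
  rw [← Finset.add_sum_erase _ _ hj, neg_add_cancel, partialHat_zero_right R hB, norm_one, one_pow,
    add_eq_left] at h1
  have h2 := (Finset.sum_eq_zero_iff_of_nonneg fun _ _ => sq_nonneg _).1 h1 i
    (Finset.mem_erase.2 ⟨hij, hi⟩)
  rw [neg_add_eq_sub] at h2
  simpa using h2

theorem isLevelSpectrum_image {R : Matrix (Fin d) (Fin d) ℤ}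
    {B : Finset (Fin d → ℤ)} (hB : B.Nonempty) {n : ℕ} {ι : Type*} {s : Finset ι}
    {f : ι → Fin d → ℤ} (h : ∀ ξ, ∑ i ∈ s, ‖partialHat R B n (ξ + intVec (f i))‖ ^ 2 = 1) :
    IsLevelSpectrum R B n (s.image f) := by
  intro ξ
  rw [Finset.sum_image, h ξ]
  intro i hi j hj hij
  by_contra hne
  have h1 := partialHat_sub_eq_zero_of_sum_eq_one hB h hi hj hne
  change f i = f j at hij
  rw [hij, sub_self, partialHat_zero_right R hB] at h1
  exact one_ne_zero h1

theorem isLevelSpectrum_zero (R : Matrix (Fin d) (Fin d) ℤ) (B : Finset (Fin d → ℤ)) :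
    IsLevelSpectrum R B 0 {0} := by
  intro ξ
  simp [partialHat]

/-- Spectra `Λ` of level `m` and `J` of level `p` compose to the spectrum `Λ + (Rᵀ)ᵐ J` of level
`m + p`; here the points of `J` may first be moved by elements of `(Rᵀ)ᵖ ℤᵈ`. -/
theorem IsLevelSpectrum.compose {R : Matrix (Fin d) (Fin d) ℤ} (hR : IsExpansive R)
    {B : Finset (Fin d → ℤ)} (hB : B.Nonempty) {m p : ℕ} {Λ J : Finset (Fin d → ℤ)}
    (hΛ : IsLevelSpectrum R B m Λ) (hJ : IsLevelSpectrum R B p J)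
    (k : (Fin d → ℤ) → Fin d → ℤ) :
    IsLevelSpectrum R B (m + p) ((Λ ×ˢ J).image fun q => q.1 +
      (R.transpose ^ m).mulVec (q.2 + (R.transpose ^ p).mulVec (k q.2))) := by
  refine isLevelSpectrum_image hB fun ξ => ?_
  rw [Finset.sum_product, ← hΛ ξ]
  refine Finset.sum_congr rfl fun lam _ => ?_
  rw [← mul_one (‖partialHat R B m (ξ + intVec lam)‖ ^ 2),
    ← hJ ((star (invMap R) ^ m) (ξ + intVec lam)), Finset.mul_sum]
  refine Finset.sum_congr rfl fun j _ => ?_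
  rw [intVec_add, ← add_assoc, partialHat_add, partialHat_add_intVec hR, map_add _ (ξ + _),
    star_invMap_pow_intVec hR, intVec_add, ← add_assoc, partialHat_add_intVec hR, norm_mul, mul_pow]

/-- The isometry `H` maps the unit vector `N^{-1/2} (exp(2πi⟨(Rᵀ)⁻¹ξ, b⟩))_b` to the conjugates of
the numbers `m_B((Rᵀ)⁻¹(ξ + ℓ))`. -/
theorem IsHadamardTriple.isLevelSpectrum_one {R : Matrix (Fin d) (Fin d) ℤ}
    {B L : Finset (Fin d → ℤ)} (h : IsHadamardTriple R B L) : IsLevelSpectrum R B 1 L := by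
  intro ξ
  have hcard : (0 : ℝ) < B.card := by exact_mod_cast h.nonempty.card_pos
  have hsq : ((Real.sqrt B.card : ℝ) : ℂ) * (Real.sqrt B.card : ℝ) = B.card := by
    rw [← Complex.ofReal_mul, Real.mul_self_sqrt hcard.le, Complex.ofReal_natCast]
  set w : B → ℂ := fun b => (1 / (Real.sqrt (B.card : ℝ) : ℂ)) *
    Complex.exp (2 * Real.pi * Complex.I *
      ((inner ℝ (star (invMap R) ξ) (intVec b.1) : ℝ) : ℂ)) with hw
  have hHw : ∀ ℓ : L, ((hadamardMatrix R B L).mulVec w) ℓ =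
      (starRingEnd ℂ) (partialHat R B 1 (ξ + intVec ℓ.1)) := by
    intro ℓ
    rw [partialHat_one, maskFun, map_mul, map_sum, map_inv₀, Complex.conj_natCast, Finset.mul_sum,
      ← Finset.sum_coe_sort B, Matrix.mulVec, dotProduct]
    refine Finset.sum_congr rfl fun b _ => ?_
    rw [← Complex.exp_conj, hadamardMatrix, Matrix.of_apply, hw, mul_mul_mul_comm,
      ← Complex.exp_add]
    congr 1
    · rw [← hsq]
      field_simp
    · congr 1
      simp only [map_neg, map_mul, map_ofNat, Complex.conj_I, Complex.conj_ofReal, map_add,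
        inner_add_left, ContinuousLinearMap.star_eq_adjoint,
        ContinuousLinearMap.adjoint_inner_left]
      rw [real_inner_comm (intVec ℓ.1)]
      push_cast
      ring
  have hww : star w ⬝ᵥ w = 1 := by
    have h1 : ∀ b : B, star w b * w b = (B.card : ℂ)⁻¹ := by
      intro b
      have hn : ‖w b‖ = 1 / Real.sqrt B.card := by
        rw [hw]
        simp only
        rw [norm_mul, norm_exp_two_pi_inner, mul_one, norm_div, norm_one, Complex.norm_real,
          Real.norm_of_nonneg (Real.sqrt_nonneg _)]
      rw [Pi.star_apply, RCLike.star_def, ← Complex.normSq_eq_conj_mul_self,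
        Complex.normSq_eq_norm_sq, hn, div_pow, Real.sq_sqrt hcard.le]
      simp
    rw [dotProduct, Finset.sum_congr rfl fun b _ => h1 b, Finset.sum_const, Finset.card_univ,
      Fintype.card_coe, nsmul_eq_mul, mul_inv_cancel₀]
    exact_mod_cast hcard.ne'
  have hmain : star ((hadamardMatrix R B L).mulVec w) ⬝ᵥ (hadamardMatrix R B L).mulVec w = 1 := by
    rw [Matrix.star_mulVec, Matrix.dotProduct_mulVec, Matrix.vecMul_vecMul, h.isometry,
      Matrix.vecMul_one, hww]
  rw [← Finset.sum_coe_sort L, ← Complex.ofReal_inj, Complex.ofReal_one, ← hmain, dotProduct,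
    Complex.ofReal_sum]
  refine Finset.sum_congr rfl fun ℓ _ => ?_
  rw [Pi.star_apply, hHw, RCLike.star_def, Complex.conj_conj, Complex.mul_conj,
    Complex.normSq_eq_norm_sq]

/-- Every level has a spectrum. That it can be chosen to contain `0` is what allows spectra of
successive levels to be nested. -/
theorem IsHadamardTriple.exists_isLevelSpectrum {R : Matrix (Fin d) (Fin d) ℤ}
    {B L : Finset (Fin d → ℤ)} (h : IsHadamardTriple R B L) (p : ℕ) :
    ∃ J, IsLevelSpectrum R B p J ∧ 0 ∈ J := by
  have hL : L.Nonempty := by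
    rw [← Finset.card_pos, ← h.card_eq]
    exact h.nonempty.card_pos
  obtain ⟨l₀, hl₀⟩ := hL
  have h1 : IsLevelSpectrum R B 1 (L.image fun l => l + -l₀) := by
    refine isLevelSpectrum_image h.nonempty fun ξ => ?_
    rw [← h.isLevelSpectrum_one (ξ + intVec (-l₀))]
    refine Finset.sum_congr rfl fun l _ => ?_
    rw [intVec_add, add_right_comm, add_assoc]
  have h10 : (0 : Fin d → ℤ) ∈ L.image fun l => l + -l₀ :=
    Finset.mem_image.2 ⟨l₀, hl₀, add_neg_cancel l₀⟩
  induction p with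
  | zero => exact ⟨{0}, isLevelSpectrum_zero R B, Finset.mem_singleton_self 0⟩
  | succ p ih =>
    obtain ⟨J, hJ, hJ0⟩ := ih
    refine ⟨_, hJ.compose h.expansive h.nonempty h1 fun _ => 0, ?_⟩
    exact Finset.mem_image.2 ⟨(0, 0), Finset.mem_product.2 ⟨hJ0, h10⟩, by simp⟩

/-! ### Uniform lower bounds -/

theorem isCompact_unitCube : IsCompact {x : EuclideanSpace ℝ (Fin d) | ∀ i, x i ∈ Set.Icc 0 1} := by
  have h : IsCompact (Set.pi Set.univ fun _ : Fin d => Set.Icc (0 : ℝ) 1) :=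
    isCompact_univ_pi fun _ => isCompact_Icc
  have h2 := h.image (PiLp.continuous_toLp 2 fun _ : Fin d => ℝ)
  convert h2 using 1
  ext x
  constructor
  · intro hx
    exact ⟨fun i => x i, fun i _ => hx i, rfl⟩
  · rintro ⟨y, hy, rfl⟩ i
    exact hy i trivial

theorem exists_uniform_bound_of_ne_zero {g : EuclideanSpace ℝ (Fin d) → ℂ} (hg : Continuous g)
    {x : EuclideanSpace ℝ (Fin d)} (hx : g x ≠ 0) :
    ∃ ε > 0, ∃ δ > 0, ∀ x' y, ‖x' - x‖ < δ → ‖y‖ < δ → ε ≤ ‖g (x' + y)‖ := by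
  have hpos : 0 < ‖g x‖ := norm_pos_iff.2 hx
  have hev : ∀ᶠ z in nhds x, ‖g x‖ / 2 < ‖g z‖ :=
    hg.norm.continuousAt.eventually (lt_mem_nhds (by linarith))
  obtain ⟨r, hr, hball⟩ := Metric.eventually_nhds_iff.1 hev
  refine ⟨‖g x‖ / 2, by linarith, r / 2, by linarith, fun x' y hx' hy => (hball ?_).le⟩
  rw [dist_eq_norm, add_sub_right_comm]
  exact (norm_add_le _ _).trans_lt (by linarith)

/-- If the periodic zero set is empty, then `|μ̂|` has a positive lower bound on balls of a fixed
radius, one around a suitable translate of each point by an integer vector; by compactness of the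
unit cube. -/
theorem exists_uniform_bound {μ : Measure (EuclideanSpace ℝ (Fin d))} [IsProbabilityMeasure μ]
    (hZ : periodicZeroSet μ = ∅) :
    ∃ ε > 0, ∃ δ > 0, ∃ k : EuclideanSpace ℝ (Fin d) → Fin d → ℤ, k 0 = 0 ∧
      ∀ x y, ‖y‖ < δ → ε ≤ ‖fourierHat μ (x + intVec (k x) + y)‖ := by
  have hc := continuous_fourierHat μ
  have hcube : ∃ ε > 0, ∃ δ > 0, ∀ x ∈ {x : EuclideanSpace ℝ (Fin d) | ∀ i, x i ∈ Set.Icc 0 1},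
      ∃ k, ∀ y, ‖y‖ < δ → ε ≤ ‖fourierHat μ (x + intVec k + y)‖ := by
    refine isCompact_unitCube.induction_on
      (p := fun s => ∃ ε > 0, ∃ δ > 0, ∀ x ∈ s, ∃ k : Fin d → ℤ, ∀ y, ‖y‖ < δ →
        ε ≤ ‖fourierHat μ (x + intVec k + y)‖) ?_ ?_ ?_ ?_
    · exact ⟨1, one_pos, 1, one_pos, fun x hx => hx.elim⟩
    · rintro s t hst ⟨ε, hε, δ, hδ, h⟩
      exact ⟨ε, hε, δ, hδ, fun x hx => h x (hst hx)⟩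
    · rintro s t ⟨ε₁, hε₁, δ₁, hδ₁, h₁⟩ ⟨ε₂, hε₂, δ₂, hδ₂, h₂⟩
      refine ⟨min ε₁ ε₂, lt_min hε₁ hε₂, min δ₁ δ₂, lt_min hδ₁ hδ₂, ?_⟩
      rintro x (hx | hx)
      · obtain ⟨k, hk⟩ := h₁ x hx
        exact ⟨k, fun y hy => (min_le_left _ _).trans (hk y (hy.trans_le (min_le_left _ _)))⟩
      · obtain ⟨k, hk⟩ := h₂ x hx
        exact ⟨k, fun y hy => (min_le_right _ _).trans (hk y (hy.trans_le (min_le_right _ _)))⟩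
    · intro x _
      have hx : ∃ k : Fin d → ℤ, fourierHat μ (x + intVec k) ≠ 0 := by
        by_contra hcon
        push Not at hcon
        have hmem : x ∈ periodicZeroSet μ := hcon
        rw [hZ] at hmem
        exact hmem
      obtain ⟨k, hk⟩ := hx
      obtain ⟨ε, hε, δ, hδ, h⟩ := exists_uniform_bound_of_ne_zero hc hk
      refine ⟨Metric.ball x δ, mem_nhdsWithin_of_mem_nhds (Metric.ball_mem_nhds x hδ),
        ε, hε, δ, hδ, fun x' hx' => ⟨k, fun y hy => h _ _ ?_ hy⟩⟩
      rwa [add_sub_add_right_eq_sub, ← dist_eq_norm]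
  obtain ⟨ε₁, hε₁, δ₁, hδ₁, h₁⟩ := hcube
  obtain ⟨ε₂, hε₂, δ₂, hδ₂, h₂⟩ := exists_uniform_bound_of_ne_zero hc (x := 0)
    (by rw [fourierHat_zero]; exact one_ne_zero)
  have hall : ∀ x, ∃ k : Fin d → ℤ, (x = 0 → k = 0) ∧ ∀ y, ‖y‖ < min δ₁ δ₂ →
      min ε₁ ε₂ ≤ ‖fourierHat μ (x + intVec k + y)‖ := by
    intro x
    by_cases hx0 : x = 0
    · refine ⟨0, fun _ => rfl, fun y hy => (min_le_right _ _).trans ?_⟩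
      rw [hx0, intVec_zero, add_zero]
      exact h₂ 0 y (by simpa using hδ₂) (hy.trans_le (min_le_right _ _))
    · let f : Fin d → ℤ := fun i => ⌊x i⌋
      obtain ⟨k, hk⟩ := h₁ (x - intVec f) fun i =>
        ⟨sub_nonneg.2 (Int.floor_le _), (sub_le_iff_le_add'.2 (Int.lt_floor_add_one _).le)⟩
      refine ⟨-f + k, fun h => absurd h hx0, fun y hy => (min_le_left _ _).trans ?_⟩
      have := hk y (hy.trans_le (min_le_left _ _))
      rwa [intVec_add, intVec_neg, ← add_assoc, ← sub_eq_add_neg]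
  choose k hk0 hk using hall
  exact ⟨min ε₁ ε₂, lt_min hε₁ hε₂, min δ₁ δ₂, lt_min hδ₁ hδ₂, k, hk0 0 rfl, hk⟩

/-! ### The spectrum -/

/-- Any spectrum of level `m` extends to one of a higher level `n` at whose points the tail
`μ̂((Rᵀ)⁻ⁿ(ξ + λ))` of the infinite product is bounded below, for `ξ` in a given ball. -/
theorem IsHadamardTriple.exists_isLevelSpectrum_superset {R : Matrix (Fin d) (Fin d) ℤ}
    {B L : Finset (Fin d → ℤ)} (h : IsHadamardTriple R B L)
    {μ : Measure (EuclideanSpace ℝ (Fin d))} {ε δ : ℝ} (hδ : 0 < δ)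
    {k : EuclideanSpace ℝ (Fin d) → Fin d → ℤ} (hk0 : k 0 = 0)
    (hk : ∀ x y, ‖y‖ < δ → ε ≤ ‖fourierHat μ (x + intVec (k x) + y)‖)
    (r : ℝ) {m : ℕ} {Λ : Finset (Fin d → ℤ)} (hΛ : IsLevelSpectrum R B m Λ) :
    ∃ n Λ', m < n ∧ Λ ⊆ Λ' ∧ IsLevelSpectrum R B n Λ' ∧ ∀ lam ∈ Λ', ∀ ξ, ‖ξ‖ ≤ r →
      ε ≤ ‖fourierHat μ ((star (invMap R) ^ n) (ξ + intVec lam))‖ := by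
  set T := star (invMap R) with hT
  obtain ⟨C, hC⟩ : ∃ C : ℝ, ∀ lam ∈ Λ, ‖intVec lam‖ ≤ C := by
    obtain ⟨C, hC⟩ := (Λ.finite_toSet.image fun lam => ‖intVec lam‖).bddAbove
    exact ⟨C, fun lam hlam => hC ⟨lam, hlam, rfl⟩⟩
  -- `p` is so large that the `(Rᵀ)⁻⁽ᵐ⁺ᵖ⁾(ξ + λ)` with `λ ∈ Λ`, `‖ξ‖ ≤ r`, are shorter than `δ`.
  have hlim : Filter.Tendsto (fun p : ℕ => ‖T ^ (m + p)‖ * (|r| + |C|)) Filter.atTop (nhds 0) := by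
    have h1 := (summable_norm_pow_of_expansive h.expansive).tendsto_atTop_zero.mul_const (|r| + |C|)
    rw [zero_mul] at h1
    have h2 := h1.comp (Filter.tendsto_add_atTop_nat m)
    refine h2.congr fun p => ?_
    simp only [Function.comp]
    rw [hT, ← star_pow, ContinuousLinearMap.star_eq_adjoint, LinearIsometryEquiv.norm_map,
      add_comm p m]
  obtain ⟨p, hp, hp0⟩ := ((hlim.eventually (gt_mem_nhds hδ)).and
    (Filter.eventually_gt_atTop 0)).exists
  obtain ⟨J, hJ, hJ0⟩ := h.exists_isLevelSpectrum p
  refine ⟨m + p, _, by omega, ?_, hΛ.compose h.expansive h.nonempty hJ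
    fun j => k ((T ^ p) (intVec j)), ?_⟩
  · intro lam hlam
    refine Finset.mem_image.2 ⟨(lam, 0), Finset.mem_product.2 ⟨hlam, hJ0⟩, ?_⟩
    simp [intVec_zero, hk0]
  · intro lam' hlam' ξ hξ
    obtain ⟨⟨lam, j⟩, hq, rfl⟩ := Finset.mem_image.1 hlam'
    obtain ⟨hlam, hj⟩ := Finset.mem_product.1 hq
    have hsplit : (T ^ (m + p)) (ξ + intVec (lam + (R.transpose ^ m).mulVec
        (j + (R.transpose ^ p).mulVec (k ((T ^ p) (intVec j)))))) =
        (T ^ p) (intVec j) + intVec (k ((T ^ p) (intVec j))) +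
          (T ^ (m + p)) (ξ + intVec lam) := by
      rw [intVec_add, ← add_assoc, map_add _ (ξ + intVec lam), add_comm]
      congr 1
      rw [add_comm m p, pow_add]
      change (T ^ p) ((T ^ m) _) = _
      rw [star_invMap_pow_intVec h.expansive, intVec_add, map_add,
        star_invMap_pow_intVec h.expansive]
    simp only
    rw [hsplit]
    refine hk _ _ (lt_of_le_of_lt ?_ hp)
    refine (ContinuousLinearMap.le_opNorm _ _).trans
      (mul_le_mul_of_nonneg_left ?_ (norm_nonneg _))
    exact (norm_add_le _ _).trans
      (add_le_add (hξ.trans (le_abs_self r)) ((hC lam hlam).trans (le_abs_self C)))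

/-- A self-affine measure is spectral, with a spectrum of integer vectors, as soon as its level
measures have an increasing sequence of spectra along which the tails of the infinite product are
bounded below. -/
theorem IsSelfAffineMeasure.isSpectrum_of_tower {R : Matrix (Fin d) (Fin d) ℤ}
    (hR : IsExpansive R) {B : Finset (Fin d → ℤ)} (hB : B.Nonempty)
    {μ : Measure (EuclideanSpace ℝ (Fin d))} (hμ : IsSelfAffineMeasure R B μ) {ε : ℝ} (hε : 0 < ε)
    {m : ℕ → ℕ} (hm : StrictMono m) {Λ : ℕ → Finset (Fin d → ℤ)} (hmono : Monotone Λ)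
    (hΛ : ∀ n, IsLevelSpectrum R B (m n) (Λ n))
    (hbound : ∀ ξ : EuclideanSpace ℝ (Fin d), ∀ᶠ n in Filter.atTop, ∀ lam ∈ Λ n,
      ε ≤ ‖fourierHat μ ((star (invMap R) ^ (m n)) (ξ + intVec lam))‖) :
    IsSpectrum μ (intVec '' ⋃ n, (Λ n : Set (Fin d → ℤ))) := by
  have := hμ.isProbabilityMeasure
  have hcount : (intVec '' ⋃ n, (Λ n : Set (Fin d → ℤ))).Countable := (Set.to_countable _).image _
  have horth : ∀ lam ∈ intVec '' ⋃ n, (Λ n : Set (Fin d → ℤ)),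
      ∀ lam' ∈ intVec '' ⋃ n, (Λ n : Set (Fin d → ℤ)), lam ≠ lam' →
      fourierHat μ (lam - lam') = 0 := by
    rintro _ ⟨k, hk, rfl⟩ _ ⟨l, hl, rfl⟩ hne
    obtain ⟨i, hi⟩ := Set.mem_iUnion.1 hk
    obtain ⟨j, hj⟩ := Set.mem_iUnion.1 hl
    have h0 : partialHat R B (m (max i j)) (intVec k - intVec l) = 0 :=
      partialHat_sub_eq_zero_of_sum_eq_one (f := fun k => k) hB (hΛ (max i j))
        (hmono (le_max_left i j) hi) (hmono (le_max_right i j) hj) fun h => hne (congrArg _ h)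
    rw [hμ.fourierHat_eq_partialHat_mul hB (m (max i j)), h0, zero_mul]
  refine isSpectrum_of_hasSum hcount horth fun ξ => ?_
  -- Reindex by integer vectors.
  rw [← (Equiv.Set.image intVec (⋃ n, (Λ n : Set (Fin d → ℤ))) intVec_injective).hasSum_iff]
  change HasSum (fun lam : ↥(⋃ n, (Λ n : Set (Fin d → ℤ))) =>
    ‖fourierHat μ (ξ + intVec lam.1)‖ ^ 2) 1
  -- Bessel's inequality provides the summable majorant.
  have hsummable : Summable fun lam : ↥(⋃ n, (Λ n : Set (Fin d → ℤ))) =>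
      ‖fourierHat μ (ξ + intVec lam.1)‖ ^ 2 := by
    have hv : Orthonormal ℂ fun lam : ↥(⋃ n, (Λ n : Set (Fin d → ℤ))) =>
        expLp μ (intVec lam.1) := by
      refine ⟨fun lam => norm_expLp μ _, fun lam lam' hne => ?_⟩
      change inner ℂ (expLp μ _) (expLp μ _) = 0
      rw [inner_expLp_expLp]
      exact horth _ ⟨_, lam.2, rfl⟩ _ ⟨_, lam'.2, rfl⟩ fun h =>
        hne (Subtype.ext (intVec_injective h))
    refine (hv.inner_products_summable (expLp μ (-ξ))).congr fun lam => ?_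
    rw [inner_expLp_expLp, sub_neg_eq_add, add_comm]
  classical
  have hlim := tendsto_tsum_of_dominated_convergence (𝓕 := Filter.atTop)
    (f := fun n (lam : ↥(⋃ n, (Λ n : Set (Fin d → ℤ)))) =>
      if lam.1 ∈ Λ n then ‖partialHat R B (m n) (ξ + intVec lam.1)‖ ^ 2 else 0)
    (g := fun lam => ‖fourierHat μ (ξ + intVec lam.1)‖ ^ 2)
    (hsummable.mul_left (ε ^ 2)⁻¹) ?_ ?_
  · have hone : ∀ n, ∑' lam : ↥(⋃ n, (Λ n : Set (Fin d → ℤ))),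
        (if lam.1 ∈ Λ n then ‖partialHat R B (m n) (ξ + intVec lam.1)‖ ^ 2 else 0) = 1 := by
      intro n
      rw [← hΛ n ξ, tsum_subtype (⋃ n, (Λ n : Set (Fin d → ℤ)))
        fun k => if k ∈ Λ n then ‖partialHat R B (m n) (ξ + intVec k)‖ ^ 2 else 0]
      rw [tsum_eq_sum (s := Λ n)]
      · refine Finset.sum_congr rfl fun k hk => ?_
        rw [Set.indicator_of_mem (Set.mem_iUnion.2 ⟨n, hk⟩), if_pos hk]
      · intro k hk
        simp [Set.indicator_apply, hk]
    simp only [hone] at hlim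
    rw [tendsto_nhds_unique tendsto_const_nhds hlim]
    exact hsummable.hasSum
  · rintro ⟨lam, hlam⟩
    obtain ⟨i, hi⟩ := Set.mem_iUnion.1 hlam
    have h1 := (((hμ.tendsto_partialHat hR hB (ξ + intVec lam)).comp hm.tendsto_atTop).norm).pow 2
    refine h1.congr' ?_
    filter_upwards [Filter.eventually_ge_atTop i] with n hn
    exact (if_pos (hmono hn hi)).symm
  · filter_upwards [hbound ξ] with n hn lam
    split_ifs with hmem
    · have hb := hn lam.1 hmem
      rw [norm_pow, norm_norm, hμ.fourierHat_eq_partialHat_mul hB (m n), norm_mul, mul_pow,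
        inv_mul_eq_div, le_div_iff₀ (by positivity)]
      gcongr
    · rw [norm_zero]
      positivity

theorem IsHadamardTriple.exists_isSpectrum {R : Matrix (Fin d) (Fin d) ℤ}
    {B L : Finset (Fin d → ℤ)} (h : IsHadamardTriple R B L)
    {μ : Measure (EuclideanSpace ℝ (Fin d))} (hμ : IsSelfAffineMeasure R B μ)
    (hZ : periodicZeroSet μ = ∅) :
    ∃ Λ : Set (EuclideanSpace ℝ (Fin d)), Λ ⊆ Set.range intVec ∧ IsSpectrum μ Λ := by
  have := hμ.isProbabilityMeasure
  obtain ⟨ε, hε, δ, hδ, k, hk0, hk⟩ := exists_uniform_bound hZ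
  let S := {q : ℕ × Finset (Fin d → ℤ) // IsLevelSpectrum R B q.1 q.2}
  have hstep : ∀ (n : ℕ) (q : S), ∃ q' : S, q.1.1 < q'.1.1 ∧ q.1.2 ⊆ q'.1.2 ∧
      ∀ lam ∈ q'.1.2, ∀ ξ : EuclideanSpace ℝ (Fin d), ‖ξ‖ ≤ n →
        ε ≤ ‖fourierHat μ ((star (invMap R) ^ q'.1.1) (ξ + intVec lam))‖ := by
    intro n q
    obtain ⟨m, Λ, h1, h2, h3, h4⟩ := h.exists_isLevelSpectrum_superset hδ hk0 hk n q.2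
    exact ⟨⟨(m, Λ), h3⟩, h1, h2, h4⟩
  choose next hlt hsub hbd using hstep
  let s : ℕ → S := fun n => Nat.rec ⟨(0, {0}), isLevelSpectrum_zero R B⟩ next n
  refine ⟨_, ?_, hμ.isSpectrum_of_tower h.expansive h.nonempty hε
    (m := fun n => (s n).1.1) (strictMono_nat_of_lt_succ fun n => hlt n (s n))
    (Λ := fun n => (s n).1.2) (monotone_nat_of_le_succ fun n => hsub n (s n))
    (fun n => (s n).2) fun ξ => ?_⟩
  · rintro _ ⟨l, -, rfl⟩
    exact ⟨l, rfl⟩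
  · obtain ⟨n₀, hn₀⟩ := exists_nat_ge ‖ξ‖
    filter_upwards [Filter.eventually_ge_atTop (n₀ + 1)] with n hn lam hlam
    obtain ⟨n, rfl⟩ : ∃ n', n = n' + 1 := ⟨n - 1, by omega⟩
    refine hbd n (s n) lam hlam ξ (hn₀.trans ?_)
    exact_mod_cast (by omega : n₀ ≤ n)

/-- By Parseval's identity for the exponential of frequency `-ξ`, the numbers `μ̂(ξ + λ)` with `λ`
in an integral spectrum do not all vanish. -/
theorem periodicZeroSet_eq_empty_of_isSpectrum {μ : Measure (EuclideanSpace ℝ (Fin d))}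
    [IsProbabilityMeasure μ] {Λ : Set (EuclideanSpace ℝ (Fin d))} (hΛ : Λ ⊆ Set.range intVec)
    (h : IsSpectrum μ Λ) : periodicZeroSet μ = ∅ := by
  rw [Set.eq_empty_iff_forall_notMem]
  intro ξ hξ
  have h0 : (fun lam : Λ => ‖fourierHat μ (ξ + lam)‖ ^ 2) = fun _ => 0 := by
    funext lam
    obtain ⟨k, hk⟩ := hΛ lam.2
    rw [← hk, hξ k, norm_zero, zero_pow two_ne_zero]
  have h1 := h.hasSum ξ
  rw [h0] at h1
  exact one_ne_zero (h1.unique hasSum_zero)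

theorem mainTheorem3 {d : ℕ} (R : Matrix (Fin d) (Fin d) ℤ) (B L : Finset (Fin d → ℤ))
    (h : IsHadamardTriple R B L) :
    (periodicZeroSet (selfAffineMeasure R B) = ∅ ↔
      ∃ Λ : Set (EuclideanSpace ℝ (Fin d)),
        Λ ⊆ Set.range intVec ∧ IsSpectrum (selfAffineMeasure R B) Λ) ∧
    (periodicZeroSet (selfAffineMeasure R B) = ∅ →
      IsSpectralMeasure (selfAffineMeasure R B)) := by
  have hμ := isSelfAffineMeasure_selfAffineMeasure h.expansive h.nonempty
  have := hμ.isProbabilityMeasure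
  refine ⟨⟨h.exists_isSpectrum hμ, fun ⟨_, hΛ, hs⟩ =>
    periodicZeroSet_eq_empty_of_isSpectrum hΛ hs⟩, fun hZ => ?_⟩
  obtain ⟨Λ, -, hΛ⟩ := h.exists_isSpectrum hμ hZ
  exact ⟨Λ, hΛ⟩
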